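/- Let $h$ be a Euclidean metric (a positive definite symmetric bilinear form) on $\mathbb{R}^n$, with components $h_{ij}$ and inverse $h^{ij}$, let $\kappa>0$, and let $P$ be a homogeneous cubic polynomial on $\mathbb{R}^n$ that solves $$\Delta_h P = h^{ij}\partial_i\partial_j P = 0,\qquad |\mathrm{Hess}\,P|_h^2 = h^{ik}h^{jl}(\partial_i\partial_jP)(\partial_k\partial_lP) = \kappa\,|x|_h^2 .$$ Let $\mathrm{Aut}(P)=\{g\in O(h): P(gx)=P(x)\text{ for all }x\in\mathbb{R}^n\}$ be the automorphism group of $P$, a closed subgroup of the orthogonal group $O(h)$ and hence a Lie group. If $\mathrm{Aut}(P)$ has positive dimension, then $n\ge 5$. -/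

import Mathlib

namespace EinsteinPolynomial

open MvPolynomial

/-- The `h`-Laplacian `h^{ij} D_i D_j P` of a polynomial on `ℝⁿ`, where `h` is the Gram matrix of a
metric on `ℝⁿ` and `h^{ij}` are the entries of the inverse matrix. -/
noncomputable def laplacian {n : ℕ} (h : Matrix (Fin n) (Fin n) ℝ)
    (P : MvPolynomial (Fin n) ℝ) : MvPolynomial (Fin n) ℝ :=
  ∑ i, ∑ j, C (h⁻¹ i j) * pderiv i (pderiv j P)

/-- The squared norm `h^{ik} h^{jl} P_{ij} P_{kl}` of the Hessian of a polynomial on `ℝⁿ`, by complete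
contraction with the inverse metric; it is again a polynomial on `ℝⁿ`. -/
noncomputable def hessNormSq {n : ℕ} (h : Matrix (Fin n) (Fin n) ℝ)
    (P : MvPolynomial (Fin n) ℝ) : MvPolynomial (Fin n) ℝ :=
  ∑ i, ∑ j, ∑ k, ∑ l,
    C (h⁻¹ i k * h⁻¹ j l) * (pderiv i (pderiv j P) * pderiv k (pderiv l P))

/-- The quadratic polynomial `|x|² = h_{ij} x^i x^j` of the metric `h`. -/
noncomputable def normSq {n : ℕ} (h : Matrix (Fin n) (Fin n) ℝ) : MvPolynomial (Fin n) ℝ :=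
  ∑ i, ∑ j, C (h i j) * (X i * X j)

/-- `P` is a homogeneous cubic polynomial on `ℝⁿ` that solves the system
`Δ_h P = 0`, `|Hess P|²_h = κ |x|²_h`. -/
structure IsSolution {n : ℕ} (h : Matrix (Fin n) (Fin n) ℝ) (κ : ℝ)
    (P : MvPolynomial (Fin n) ℝ) : Prop where
  homogeneous : P.IsHomogeneous 3
  harmonic : laplacian h P = 0
  hess : hessNormSq h P = C κ * normSq h

/-- The automorphism group of a polynomial `P` on the metric vector space `(ℝⁿ, h)`: the subgroup of
`GL(n, ℝ)` of the linear isometries of `h` that preserve `P`. -/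
def automorphismGroup {n : ℕ} (h : Matrix (Fin n) (Fin n) ℝ)
    (P : MvPolynomial (Fin n) ℝ) : Subgroup (GL (Fin n) ℝ) where
  carrier := {g | (g : Matrix (Fin n) (Fin n) ℝ).transpose * h * (g : Matrix (Fin n) (Fin n) ℝ) = h ∧
    ∀ x : Fin n → ℝ, eval ((g : Matrix (Fin n) (Fin n) ℝ).mulVec x) P = eval x P}
  one_mem' := by simp
  mul_mem' := by
    rintro a b ⟨ha, ha'⟩ ⟨hb, hb'⟩
    refine ⟨?_, fun x => ?_⟩
    · rw [Units.val_mul, Matrix.transpose_mul]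
      calc _ = (b : Matrix (Fin n) (Fin n) ℝ).transpose *
            ((a : Matrix (Fin n) (Fin n) ℝ).transpose * h * (a : Matrix (Fin n) (Fin n) ℝ)) *
            (b : Matrix (Fin n) (Fin n) ℝ) := by simp only [Matrix.mul_assoc]
        _ = h := by rw [ha, hb]
    · rw [Units.val_mul, ← Matrix.mulVec_mulVec, ha', hb']
  inv_mem' := by
    rintro a ⟨ha, ha'⟩
    have e : (a : Matrix (Fin n) (Fin n) ℝ) * (a⁻¹ : GL (Fin n) ℝ) = 1 := a.mul_inv
    have e' := congrArg Matrix.transpose e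
    rw [Matrix.transpose_mul, Matrix.transpose_one] at e'
    refine ⟨?_, fun x => ?_⟩
    · calc _ = ((a⁻¹ : GL (Fin n) ℝ) : Matrix (Fin n) (Fin n) ℝ).transpose *
            ((a : Matrix (Fin n) (Fin n) ℝ).transpose * h * (a : Matrix (Fin n) (Fin n) ℝ)) *
            ((a⁻¹ : GL (Fin n) ℝ) : Matrix (Fin n) (Fin n) ℝ) := by rw [ha]
        _ = (((a⁻¹ : GL (Fin n) ℝ) : Matrix (Fin n) (Fin n) ℝ).transpose *
              (a : Matrix (Fin n) (Fin n) ℝ).transpose) * h *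
            ((a : Matrix (Fin n) (Fin n) ℝ) * ((a⁻¹ : GL (Fin n) ℝ) : Matrix (Fin n) (Fin n) ℝ)) := by
              simp only [Matrix.mul_assoc]
        _ = h := by rw [e, e', Matrix.one_mul, Matrix.mul_one]
    · rw [← ha', Matrix.mulVec_mulVec, e, Matrix.one_mulVec]

/-- The Lie algebra of a closed subgroup `G` of `GL(n, ℝ)`: the matrices `X` such that `exp (t X)` lies
in `G` for all real `t`. For closed `G` these matrices already form a linear subspace, so that taking the
linear span adds nothing and only serves to bundle them as a submodule. -/
noncomputable def lieAlgebra {n : ℕ} (G : Subgroup (GL (Fin n) ℝ)) :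
    Submodule ℝ (Matrix (Fin n) (Fin n) ℝ) :=
  Submodule.span ℝ {X | ∀ t : ℝ, ∃ g ∈ G, (g : Matrix (Fin n) (Fin n) ℝ) = NormedSpace.exp (t • X)}

/-- The dimension, as a Lie group, of a closed subgroup of `GL(n, ℝ)`: the dimension of its Lie
algebra. -/
noncomputable def lieDimension {n : ℕ} (G : Subgroup (GL (Fin n) ℝ)) : ℕ :=
  Module.finrank ℝ (lieAlgebra G)

end EinsteinPolynomial

/-! Suppose `n ≤ 4` and let `A ≠ 0` lie in the Lie algebra of the automorphism group: `A` is skew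
for `h` and its linear vector field annihilates `P`. Then `A` splits as rotations of two orthogonal
planes with speeds `p > 0` and `q`, `|q| ≤ p` (`exists_metric_rotation_frame`). In dimensions 2 and
3 the second pair of vectors degenerates, but the four vectors still resolve `h⁻¹`, so no separate
cases arise.

In this frame the third derivative of `P` is a symmetric array `t`. Invariance kills the components
of nonzero weight, harmonicity makes `t` trace-free (`cubicForm_trace`), and the Hessian equation
turns into `∑ t_abc² = κ |v_c|²` for each `c` (`cubicForm_contract`). Whether `q = 0` or not, the
surviving components are so few that the plane of unit vectors forces too large a square sum on the
second plane (`invariant_cubic_rigidity`). -/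

namespace EinsteinPolynomial

/-! ### Algebra of invariant cubic forms in four variables. -/

/-- The involution `0 ↔ 1`, `2 ↔ 3`. -/
def partner : Fin 4 → Fin 4 := ![1, 0, 3, 2]

/-- There is no symmetric trace-free cubic form in four variables that is invariant under the
rotation `p J ⊕ q J` with `|q| ≤ p` and whose contracted square is `κ > 0` on the basis vectors of
the first plane and at most `κ` on those of the second. -/
theorem invariant_cubic_rigidity {t : Fin 4 → Fin 4 → Fin 4 → ℝ} {p q κ : ℝ}
    (hp : 0 < p) (hq : |q| ≤ p) (hκ : 0 < κ)
    (hs₁ : ∀ a b c, t a b c = t b a c) (hs₂ : ∀ a b c, t a b c = t a c b)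
    (htr : ∀ c, ∑ a, t a a c = 0)
    (hinv : ∀ a b c, ![p, -p, q, -q] a * t (partner a) b c + ![p, -p, q, -q] b * t a (partner b) c +
      ![p, -p, q, -q] c * t a b (partner c) = 0)
    (h0 : ∑ a, ∑ b, t a b 0 ^ 2 = κ) (h1 : ∑ a, ∑ b, t a b 1 ^ 2 = κ)
    (h2 : ∑ a, ∑ b, t a b 2 ^ 2 ≤ κ) (h3 : ∑ a, ∑ b, t a b 3 ^ 2 ≤ κ) : False := by
  obtain ⟨hq₁, hq₂⟩ := abs_le.1 hq
  have hp' := hp.ne'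
  have s101 : t 1 0 1 = t 0 1 1 := hs₁ _ _ _
  have s102 : t 1 0 2 = t 0 1 2 := hs₁ _ _ _
  have s103 : t 1 0 3 = t 0 1 3 := hs₁ _ _ _
  have s323 : t 3 2 3 = t 2 3 3 := hs₁ _ _ _
  have i000 := hinv 0 0 0
  have i001 := hinv 0 0 1
  have i011 := hinv 0 1 1
  have i111 := hinv 1 1 1
  have i002 := hinv 0 0 2
  have i012 := hinv 0 1 2
  have i112 := hinv 1 1 2
  have i003 := hinv 0 0 3
  have i013 := hinv 0 1 3
  have i113 := hinv 1 1 3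
  have i022 := hinv 0 2 2
  have i023 := hinv 0 2 3
  have i122 := hinv 1 2 2
  have i123 := hinv 1 2 3
  have i033 := hinv 0 3 3
  have i133 := hinv 1 3 3
  have i222 := hinv 2 2 2
  have i223 := hinv 2 2 3
  have i233 := hinv 2 3 3
  have i333 := hinv 3 3 3
  have t0 := htr 0
  have t1 := htr 1
  have t2 := htr 2
  have t3 := htr 3
  simp only [partner, Matrix.cons_val, hs₁, hs₂] at i000 i001 i011 i111 i002 i012 i112 i003 i013
  simp only [partner, Matrix.cons_val, hs₁, hs₂] at i113 i022 i122 i023 i123 i033 i133 i222 i223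
  simp only [partner, Matrix.cons_val, hs₂] at i233 i333
  simp only [Fin.sum_univ_four, hs₁, hs₂] at t0 t1 t2 t3 h0 h1 h2 h3
  clear hinv htr hs₁ hs₂
  rw [s101] at i111
  rw [s102] at i112
  rw [s103] at i113
  rw [s323] at i333
  -- A plane cubic has rotation weights `±p` and `±3p`, all nonzero, so `t` vanishes on the first
  -- plane.
  have z001 : t 0 0 1 = 0 := mul_left_cancel₀ hp' (by linear_combination i000 / 3)
  have z011 : t 0 1 1 = 0 := mul_left_cancel₀ hp' (by linear_combination -i111 / 3)
  have z000 : t 0 0 0 = 0 := mul_left_cancel₀ hp' (by linear_combination -i001 + 2 * p * z011)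
  have z111 : t 1 1 1 = 0 := mul_left_cancel₀ hp' (by linear_combination i011 + 2 * p * z001)
  -- The trace-free part in two first-plane indices, paired with one second-plane index, has weights
  -- `±2p ± q`. Here `|q| ≤ p` is essential. Only the multiple of the metric survives: `t 1 1 c = t
  -- 0 0 c`.
  have hpq : (2 * p - q) * (2 * p + q) ≠ 0 :=
    (mul_pos (by linarith only [hp, hq₂]) (by linarith only [hp, hq₁])).ne'
  have z012 : t 0 1 2 = 0 :=
    mul_left_cancel₀ hpq (by linear_combination p * i002 - p * i112 + q * i013)
  have z013 : t 0 1 3 = 0 :=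
    mul_left_cancel₀ hpq (by linear_combination p * i003 - p * i113 - q * i012)
  have e112 : t 1 1 2 = t 0 0 2 := mul_left_cancel₀ hp' (by linear_combination i012 - q * z013)
  have e113 : t 1 1 3 = t 0 0 3 := mul_left_cancel₀ hp' (by linear_combination i013 + q * z012)
  rw [z000, z011] at t0
  rw [z001, z111] at t1
  rw [e112] at t2
  rw [e113] at t3
  rw [z000, z001, z011, z012, z013] at h0
  rw [z111, z001, z011, z012, z013, e112, e113] at h1
  rw [z012, e112] at h2
  rw [z013, e113] at h3
  by_cases hq0 : q = 0
  -- For `q = 0` every component with exactly one first-plane index has weight `±p` and vanishes.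
  · have z122 : t 1 2 2 = 0 :=
      mul_left_cancel₀ hp' (by linear_combination i022 - 2 * t 0 2 3 * hq0)
    have z022 : t 0 2 2 = 0 :=
      mul_left_cancel₀ hp' (by linear_combination -i122 + 2 * t 1 2 3 * hq0)
    have z123 : t 1 2 3 = 0 :=
      mul_left_cancel₀ hp' (by linear_combination i023 - (t 0 3 3 - t 0 2 2) * hq0)
    have z023 : t 0 2 3 = 0 :=
      mul_left_cancel₀ hp' (by linear_combination -i123 + (t 1 3 3 - t 1 2 2) * hq0)
    have z133 : t 1 3 3 = 0 :=
      mul_left_cancel₀ hp' (by linear_combination i033 + 2 * t 0 2 3 * hq0)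
    have z033 : t 0 3 3 = 0 :=
      mul_left_cancel₀ hp' (by linear_combination -i133 - 2 * t 1 2 3 * hq0)
    rw [z022, z023, z033] at h0
    rw [z022, z122, z123, z023] at h2
    rw [z033, z133, z123, z023] at h3
    have e2 : t 0 0 2 = -(t 2 2 2 + t 2 3 3) / 2 := by linear_combination t2 / 2
    have e3 : t 0 0 3 = -(t 2 2 3 + t 3 3 3) / 2 := by linear_combination t3 / 2
    rw [e2, e3] at h0
    rw [e2] at h2
    rw [e3] at h3
    -- Cauchy–Schwarz: `a² + 3b² ≥ 3(a + b)²/4`, with equality at `a = 3b`. Adding `h2` and `h3`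
    -- bounds the second-plane squares by `κ`, whereas `h0` and the trace relations make them at
    -- least `3κ/2`.
    have f2 := sq_nonneg (t 2 2 2 - 3 * t 2 3 3)
    have f3 := sq_nonneg (t 3 3 3 - 3 * t 2 2 3)
    linarith only [h0, h2, h3, f2, f3, hκ]
  · have z223 : t 2 2 3 = 0 := mul_left_cancel₀ hq0 (by linear_combination i222 / 3)
    have z233 : t 2 3 3 = 0 := mul_left_cancel₀ hq0 (by linear_combination -i333 / 3)
    have z222 : t 2 2 2 = 0 := mul_left_cancel₀ hq0 (by linear_combination -i223 + 2 * q * z233)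
    have z333 : t 3 3 3 = 0 := mul_left_cancel₀ hq0 (by linear_combination i233 + 2 * q * z223)
    have z002 : t 0 0 2 = 0 := mul_left_cancel₀ hq0 (by linear_combination -i003 + 2 * p * z013)
    have z003 : t 0 0 3 = 0 := mul_left_cancel₀ hq0 (by linear_combination i002 - 2 * p * z012)
    have e0 : t 0 3 3 = -t 0 2 2 := by linear_combination t0
    have e1 : t 1 3 3 = -t 1 2 2 := by linear_combination t1
    rw [z002, z003, e0] at h0
    rw [z002, z003, e1] at h1
    rw [z002, z222, z223, z233] at h2
    rw [z003, z333, z223, z233, e0, e1] at h3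
    -- Only components with one first-plane index remain; the left side of `h2` is now the sum of
    -- those of `h0` and `h1`, so `2κ ≤ κ`.
    linarith only [h0, h1, h2, h3, hκ]

/-! ### Derivations of polynomials along constant and linear vector fields. -/

open MvPolynomial

/-- The directional derivative of polynomials along a constant vector. -/
noncomputable def dirDeriv {n : ℕ} (x : Fin n → ℝ) :
    Derivation ℝ (MvPolynomial (Fin n) ℝ) (MvPolynomial (Fin n) ℝ) :=
  mkDerivation ℝ fun i => C (x i)

/-- The derivative of polynomials along the linear vector field of a matrix. -/
noncomputable def linDeriv {n : ℕ} (A : Matrix (Fin n) (Fin n) ℝ) :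
    Derivation ℝ (MvPolynomial (Fin n) ℝ) (MvPolynomial (Fin n) ℝ) :=
  mkDerivation ℝ fun i => ∑ j, C (A i j) * X j

/-- The trilinear form of the third derivative of `P` at the origin. -/
noncomputable def cubicForm {n : ℕ} (P : MvPolynomial (Fin n) ℝ) (x y z : Fin n → ℝ) : ℝ :=
  eval 0 (dirDeriv x (dirDeriv y (dirDeriv z P)))

section Derivations

variable {n : ℕ}

theorem mkDerivation_eq_sum_pderiv (f : Fin n → MvPolynomial (Fin n) ℝ)
    (P : MvPolynomial (Fin n) ℝ) : mkDerivation ℝ f P = ∑ i, f i * pderiv i P := by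
  have hc : ⇑(∑ i, f i • pderiv (R := ℝ) i) = ∑ i, ⇑(f i • pderiv (R := ℝ) i) :=
    map_sum Derivation.coeFnAddMonoidHom _ _
  have h : mkDerivation ℝ f = ∑ i, f i • pderiv i := by
    apply derivation_ext
    intro k
    rw [mkDerivation_X, hc, Finset.sum_apply]
    simp [Pi.single_apply]
  rw [h, hc, Finset.sum_apply]
  rfl

theorem dirDeriv_apply (x : Fin n → ℝ) (P : MvPolynomial (Fin n) ℝ) :
    dirDeriv x P = ∑ i, C (x i) * pderiv i P :=
  mkDerivation_eq_sum_pderiv _ P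

theorem dirDeriv_smul (r : ℝ) (x : Fin n → ℝ) (P : MvPolynomial (Fin n) ℝ) :
    dirDeriv (r • x) P = r • dirDeriv x P := by
  simp [dirDeriv_apply, Finset.smul_sum, MvPolynomial.smul_eq_C_mul, mul_assoc]

theorem dirDeriv_comm (x y : Fin n → ℝ) (P : MvPolynomial (Fin n) ℝ) :
    dirDeriv x (dirDeriv y P) = dirDeriv y (dirDeriv x P) := by
  have h : ⁅dirDeriv x, dirDeriv y⁆ = 0 := by
    apply derivation_ext
    intro k
    simp [Derivation.commutator_apply, dirDeriv]
  have := congrArg (fun D : Derivation ℝ (MvPolynomial (Fin n) ℝ) _ => D P) h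
  rwa [Derivation.commutator_apply, Derivation.zero_apply, sub_eq_zero] at this

theorem dirDeriv_linDeriv (A : Matrix (Fin n) (Fin n) ℝ) (x : Fin n → ℝ)
    (P : MvPolynomial (Fin n) ℝ) :
    dirDeriv x (linDeriv A P) = linDeriv A (dirDeriv x P) + dirDeriv (A.mulVec x) P := by
  have h : ⁅dirDeriv x, linDeriv A⁆ = dirDeriv (A.mulVec x) := by
    apply derivation_ext
    intro k
    simp [Derivation.commutator_apply, dirDeriv, linDeriv, Matrix.mulVec, dotProduct]
  have := congrArg (fun D : Derivation ℝ (MvPolynomial (Fin n) ℝ) _ => D P) h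
  rwa [Derivation.commutator_apply, sub_eq_iff_eq_add'] at this

theorem eval_zero_linDeriv (A : Matrix (Fin n) (Fin n) ℝ) (P : MvPolynomial (Fin n) ℝ) :
    eval 0 (linDeriv A P) = 0 := by
  simp [linDeriv, mkDerivation_eq_sum_pderiv]

theorem dirDeriv_dirDeriv (x y : Fin n → ℝ) (P : MvPolynomial (Fin n) ℝ) :
    dirDeriv x (dirDeriv y P) = ∑ i, ∑ j, C (x i * y j) * pderiv i (pderiv j P) := by
  simp only [dirDeriv_apply, map_sum, pderiv_C_mul, map_mul, mul_assoc]
  exact Finset.sum_comm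

theorem isHomogeneous_dirDeriv {P : MvPolynomial (Fin n) ℝ} {d : ℕ} (hP : P.IsHomogeneous d)
    (x : Fin n → ℝ) : (dirDeriv x P).IsHomogeneous (d - 1) := by
  rw [dirDeriv_apply]
  refine IsHomogeneous.sum _ _ _ fun i _ => ?_
  simpa using (isHomogeneous_C _ (x i)).mul (hP.pderiv (i := i))

theorem eval_eq_eval_zero_dirDeriv {Q : MvPolynomial (Fin n) ℝ} (hQ : Q.IsHomogeneous 1)
    (z : Fin n → ℝ) : eval z Q = eval 0 (dirDeriv z Q) := by
  have hE := hQ.sum_X_mul_pderiv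
  rw [one_smul] at hE
  conv_lhs => rw [← hE]
  rw [dirDeriv_apply, map_sum, map_sum]
  refine Finset.sum_congr rfl fun i _ => ?_
  have h0 : (pderiv i Q).IsHomogeneous 0 := hQ.pderiv
  rw [← totalDegree_zero_iff_isHomogeneous, totalDegree_eq_zero_iff_eq_C] at h0
  rw [h0]
  simp

theorem hasDerivAt_eval {σ : Type*} [Fintype σ] {c : ℝ → σ → ℝ} {c' : σ → ℝ} {s : ℝ}
    (hc : ∀ i, HasDerivAt (fun u => c u i) (c' i) s) (P : MvPolynomial σ ℝ) :
    HasDerivAt (fun u => eval (c u) P) (∑ i, c' i * eval (c s) (pderiv i P)) s := by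
  classical
  induction P using MvPolynomial.induction_on with
  | C a => simpa using hasDerivAt_const s a
  | add P Q hP hQ =>
    simp only [map_add, mul_add, Finset.sum_add_distrib]
    exact hP.add hQ
  | mul_X P k hP =>
    simp only [map_mul, eval_X]
    refine (hP.mul (hc k)).congr_deriv ?_
    simp only [pderiv_mul, pderiv_X, map_add, map_mul, eval_X, mul_add, Finset.sum_add_distrib,
      Finset.sum_mul]
    congr 1
    · exact Finset.sum_congr rfl fun i _ => by ring
    · rw [Finset.sum_eq_single k]
      · simp [mul_comm]
      · intro b _ hb
        simp [hb.symm]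
      · simp

end Derivations

/-! ### The cubic form of `P` and the two equations read in a frame. -/

section CubicForm

variable {n : ℕ} {P : MvPolynomial (Fin n) ℝ}

theorem cubicForm_swap₁₂ (x y z : Fin n → ℝ) : cubicForm P x y z = cubicForm P y x z := by
  rw [cubicForm, dirDeriv_comm, cubicForm]

theorem cubicForm_swap₂₃ (x y z : Fin n → ℝ) : cubicForm P x y z = cubicForm P x z y := by
  rw [cubicForm, dirDeriv_comm y, cubicForm]

theorem cubicForm_smul (r : ℝ) (x y z : Fin n → ℝ) :
    cubicForm P (r • x) y z = r * cubicForm P x y z := by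
  rw [cubicForm, dirDeriv_smul, MvPolynomial.smul_eval, cubicForm]

/-- Commuting three constant derivatives past `linDeriv A` leaves one term per slot; what remains in
the image of `linDeriv A` vanishes at the origin, as the vector field does. -/
theorem cubicForm_invariant {A : Matrix (Fin n) (Fin n) ℝ} (hA : linDeriv A P = 0)
    (x y z : Fin n → ℝ) :
    cubicForm P (A.mulVec x) y z + cubicForm P x (A.mulVec y) z +
      cubicForm P x y (A.mulVec z) = 0 := by
  have h := congrArg (fun Q => eval 0 (dirDeriv x (dirDeriv y (dirDeriv z Q)))) hA
  simp only [dirDeriv_linDeriv, map_add, eval_zero_linDeriv, map_zero] at h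
  unfold cubicForm
  linarith

theorem cubicForm_eq_eval (hP : P.IsHomogeneous 3) (x y z : Fin n → ℝ) :
    cubicForm P x y z = eval z (dirDeriv x (dirDeriv y P)) := by
  rw [eval_eq_eval_zero_dirDeriv (isHomogeneous_dirDeriv (isHomogeneous_dirDeriv hP y) x),
    cubicForm, dirDeriv_comm y z, dirDeriv_comm x z]

variable {h : Matrix (Fin n) (Fin n) ℝ} {ι : Type*} [Fintype ι] {v : ι → Fin n → ℝ}

theorem cubicForm_trace (hv : ∀ i j, h⁻¹ i j = ∑ a, v a i * v a j) (hP : laplacian h P = 0)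
    (z : Fin n → ℝ) : ∑ a, cubicForm P (v a) (v a) z = 0 := by
  have hL : ∑ a, dirDeriv (v a) (dirDeriv (v a) P) = 0 := by
    rw [← hP, laplacian]
    simp only [dirDeriv_dirDeriv, hv, map_sum, Finset.sum_mul]
    rw [Finset.sum_comm]
    exact Finset.sum_congr rfl fun i _ => Finset.sum_comm
  have := congrArg (fun Q => eval 0 (dirDeriv z Q)) hL
  simp only [map_sum, map_zero] at this
  rw [← this]
  refine Finset.sum_congr rfl fun a _ => ?_
  rw [cubicForm_swap₂₃, cubicForm_swap₁₂, cubicForm]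

/-- The family `v` need not be a basis: contracting with `h⁻¹` only uses `h⁻¹ = ∑ v_a v_aᵀ`, once
for each pair of indices. -/
theorem sum_dirDeriv_sq (hv : ∀ i j, h⁻¹ i j = ∑ a, v a i * v a j) :
    ∑ a, ∑ b, dirDeriv (v a) (dirDeriv (v b) P) ^ 2 = hessNormSq h P := by
  have key : ∀ f g : Fin n → MvPolynomial (Fin n) ℝ,
      ∑ a, (∑ i, C (v a i) * f i) * (∑ k, C (v a k) * g k) =
        ∑ i, ∑ k, C (h⁻¹ i k) * (f i * g k) := by
    intro f g
    simp only [hv, map_sum, Finset.sum_mul, Finset.mul_sum]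
    rw [Finset.sum_comm]
    refine (Finset.sum_congr rfl fun i _ => Finset.sum_comm).trans ?_
    rw [Finset.sum_comm]
    refine Finset.sum_congr rfl fun k _ => Finset.sum_congr rfl fun i _ =>
      Finset.sum_congr rfl fun a _ => ?_
    rw [map_mul]; ring
  calc ∑ a, ∑ b, dirDeriv (v a) (dirDeriv (v b) P) ^ 2
      = ∑ b, ∑ a, (∑ i, C (v a i) * dirDeriv (v b) (pderiv i P)) *
          (∑ k, C (v a k) * dirDeriv (v b) (pderiv k P)) := by
        rw [Finset.sum_comm]
        refine Finset.sum_congr rfl fun b _ => Finset.sum_congr rfl fun a _ => ?_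
        rw [dirDeriv_comm, dirDeriv_apply (v a), map_sum, sq]
        simp
    _ = ∑ i, ∑ k, C (h⁻¹ i k) *
          ∑ b, dirDeriv (v b) (pderiv i P) * dirDeriv (v b) (pderiv k P) := by
        simp only [key]
        simp only [Finset.mul_sum]
        rw [Finset.sum_comm]
        exact Finset.sum_congr rfl fun i _ => Finset.sum_comm
    _ = ∑ j, ∑ l, ∑ i, ∑ k, C (h⁻¹ j l) *
          (C (h⁻¹ i k) * (pderiv i (pderiv j P) * pderiv k (pderiv l P))) := by
        simp only [dirDeriv_apply, key]
        simp only [Finset.mul_sum]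
    _ = hessNormSq h P := by
        rw [hessNormSq, Finset.sum_congr rfl fun j _ => Finset.sum_comm, Finset.sum_comm]
        refine Finset.sum_congr rfl fun i _ => Finset.sum_congr rfl fun j _ => ?_
        rw [Finset.sum_comm]
        refine Finset.sum_congr rfl fun k _ => Finset.sum_congr rfl fun l _ => ?_
        rw [map_mul]; ring

theorem cubicForm_contract (hv : ∀ i j, h⁻¹ i j = ∑ a, v a i * v a j) {κ : ℝ}
    (hP : IsSolution h κ P) (z : Fin n → ℝ) :
    ∑ a, ∑ b, cubicForm P (v a) (v b) z ^ 2 = κ * (z ⬝ᵥ h.mulVec z) := by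
  have h1 := congrArg (eval z) ((sum_dirDeriv_sq (P := P) hv).trans hP.hess)
  simp only [map_sum, map_pow, ← cubicForm_eq_eval hP.homogeneous] at h1
  rw [h1]
  simp only [map_mul, eval_C, normSq, map_sum, eval_X, dotProduct, Matrix.mulVec, Finset.mul_sum]
  exact Finset.sum_congr rfl fun i _ => Finset.sum_congr rfl fun j _ => by ring

end CubicForm

/-! ### From one-parameter subgroups of automorphisms to infinitesimal symmetries. -/

section Infinitesimal

variable {n : ℕ} {P : MvPolynomial (Fin n) ℝ} {h A : Matrix (Fin n) (Fin n) ℝ}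

attribute [local instance] Matrix.linftyOpNormedRing Matrix.linftyOpNormedAlgebra in
theorem hasDerivAt_exp_smul_apply (A : Matrix (Fin n) (Fin n) ℝ) (i j : Fin n) :
    HasDerivAt (fun t : ℝ => NormedSpace.exp (t • A) i j) (A i j) 0 := by
  have h1 := hasDerivAt_exp_smul_const (𝕂 := ℝ) A 0
  rw [zero_smul, NormedSpace.exp_zero, one_mul] at h1
  exact hasDerivAt_pi.1 (hasDerivAt_pi.1 h1 i) j

theorem skew_of_exp_mem
    (hA : ∀ t : ℝ, ∃ g ∈ automorphismGroup h P,
      (g : Matrix (Fin n) (Fin n) ℝ) = NormedSpace.exp (t • A)) :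
    A.transpose * h + h * A = 0 := by
  ext i j
  have h1 := HasDerivAt.fun_sum (u := Finset.univ) fun l _ =>
    (HasDerivAt.fun_sum (u := Finset.univ) fun k _ =>
      (hasDerivAt_exp_smul_apply A k i).mul_const (h k l)).mul (hasDerivAt_exp_smul_apply A l j)
  have h2 : (fun t : ℝ => ∑ l, (∑ k, NormedSpace.exp (t • A) k i * h k l) *
      NormedSpace.exp (t • A) l j) = fun _ => h i j := by
    funext t
    obtain ⟨g, ⟨hg, -⟩, hgt⟩ := hA t
    rw [hgt] at hg
    simpa [Matrix.mul_apply] using congrFun (congrFun hg i) j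
  have h3 := (h1.congr_of_eventuallyEq (Filter.EventuallyEq.of_eq h2.symm)).unique
    (hasDerivAt_const 0 _)
  simpa [Matrix.mul_apply, Matrix.one_apply, Finset.sum_add_distrib] using h3

theorem linDeriv_eq_zero_of_exp_mem
    (hA : ∀ t : ℝ, ∃ g ∈ automorphismGroup h P,
      (g : Matrix (Fin n) (Fin n) ℝ) = NormedSpace.exp (t • A)) :
    linDeriv A P = 0 := by
  apply MvPolynomial.funext
  intro x
  have hc : ∀ i, HasDerivAt (fun t : ℝ => (NormedSpace.exp (t • A)).mulVec x i)
      (A.mulVec x i) 0 := by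
    intro i
    simp only [Matrix.mulVec, dotProduct]
    exact HasDerivAt.fun_sum fun j _ => (hasDerivAt_exp_smul_apply A i j).mul_const (x j)
  have h1 := hasDerivAt_eval hc P
  have h2 : (fun t : ℝ => eval ((NormedSpace.exp (t • A)).mulVec x) P) = fun _ => eval x P := by
    funext t
    obtain ⟨g, ⟨-, hg⟩, hgt⟩ := hA t
    rw [← hgt, hg]
  rw [h2] at h1
  have h3 := h1.unique (hasDerivAt_const 0 _)
  simpa [linDeriv, mkDerivation_eq_sum_pderiv, Matrix.mulVec, dotProduct] using h3

end Infinitesimal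


/-! ### Normal form of skew operators in dimension at most four. -/

section Frame
open scoped RealInnerProductSpace

variable {E : Type*} [NormedAddCommGroup E] [InnerProductSpace ℝ E] [FiniteDimensional ℝ E]

/-- An inner product space of dimension at most two has a Parseval frame of two vectors of
norm at most one. -/
theorem exists_parseval_pair (hd : Module.finrank ℝ E ≤ 2) :
    ∃ f₁ f₂ : E, ‖f₁‖ ≤ 1 ∧ ‖f₂‖ ≤ 1 ∧ ∀ x, ⟪f₁, x⟫ • f₁ + ⟪f₂, x⟫ • f₂ = x := by
  have b := stdOrthonormalBasis ℝ E
  generalize Module.finrank ℝ E = d at hd b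
  interval_cases d
  · refine ⟨0, 0, by simp, by simp, fun x => ?_⟩
    simpa using b.sum_repr' x
  · refine ⟨b 0, 0, (b.norm_eq_one 0).le, by simp, fun x => ?_⟩
    simpa using b.sum_repr' x
  · refine ⟨b 0, b 1, (b.norm_eq_one 0).le, (b.norm_eq_one 1).le, fun x => ?_⟩
    simpa using b.sum_repr' x

/-- A nonzero skew-adjoint operator rotates some orthonormal pair with angular velocity equal to its
operator norm. -/
theorem exists_maximal_rotation_plane {A : E →ₗ[ℝ] E} (hA : ∀ x y, ⟪A x, y⟫ = -⟪x, A y⟫)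
    (hA0 : A ≠ 0) : ∃ (e₁ e₂ : E) (p : ℝ), 0 < p ∧ ‖e₁‖ = 1 ∧ ‖e₂‖ = 1 ∧ ⟪e₁, e₂⟫ = 0 ∧
      A e₁ = p • e₂ ∧ A e₂ = -p • e₁ ∧ ∀ x, ‖A x‖ ≤ p * ‖x‖ := by
  obtain ⟨y, hy⟩ : ∃ y, A y ≠ 0 := by
    by_contra! hc
    exact hA0 (LinearMap.ext hc)
  have : Nontrivial E := nontrivial_of_ne _ _ hy
  obtain ⟨e, he, hmax⟩ := (isCompact_sphere (0 : E) 1).exists_isMaxOn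
    (NormedSpace.sphere_nonempty.2 zero_le_one) (f := fun x => ‖A x‖)
    (A.continuous_of_finiteDimensional.norm.continuousOn)
  have he1 : ‖e‖ = 1 := by simpa using he
  have hbound : ∀ x, ‖A x‖ ≤ ‖A e‖ * ‖x‖ := by
    intro x
    rcases eq_or_ne x 0 with rfl | hx
    · simp
    have hx' : 0 < ‖x‖ := norm_pos_iff.2 hx
    have h1 : ‖A (‖x‖⁻¹ • x)‖ ≤ ‖A e‖ := hmax (by simp [norm_smul, hx'.ne'])
    rw [map_smul, norm_smul, norm_inv, norm_norm, inv_mul_le_iff₀ hx'] at h1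
    linarith
  have hp : 0 < ‖A e‖ := by
    by_contra! hc
    have := hbound y
    have h0 : ‖A e‖ = 0 := le_antisymm hc (norm_nonneg _)
    rw [h0, zero_mul] at this
    exact hy (norm_le_zero_iff.1 this)
  set p := ‖A e‖ with hpdef
  -- Equality in Cauchy–Schwarz: `⟪A (A e), e⟫ = -p²` while `‖A (A e)‖ ≤ p²`, so `‖A (A e) + p² e‖²
  -- ≤ p⁴ - 2p⁴ + p⁴ = 0`.
  have hAA : A (A e) = -p ^ 2 • e := by
    have h1 : ⟪A (A e), e⟫ = -p ^ 2 := by rw [hA, real_inner_self_eq_norm_sq]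
    have h2 : ‖A (A e)‖ ≤ p * p := hbound _
    have h3 : ‖A (A e) + p ^ 2 • e‖ ^ 2 ≤ 0 := by
      rw [norm_add_sq_real, inner_smul_right, h1, norm_smul, he1, Real.norm_of_nonneg (sq_nonneg p)]
      nlinarith [norm_nonneg (A (A e))]
    have h4 : A (A e) + p ^ 2 • e = 0 := by
      rw [← norm_eq_zero]; exact pow_eq_zero_iff two_ne_zero |>.1 (le_antisymm h3 (sq_nonneg _))
    rw [eq_neg_of_add_eq_zero_left h4, neg_smul]
  refine ⟨e, p⁻¹ • A e, p, hp, he1, ?_, ?_, ?_, ?_, hbound⟩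
  · rw [norm_smul, norm_inv, Real.norm_of_nonneg hp.le, ← hpdef, inv_mul_cancel₀ hp.ne']
  · have h1 := hA e e
    rw [real_inner_comm] at h1
    rw [inner_smul_right, show ⟪e, A e⟫ = 0 by linarith, mul_zero]
  · rw [smul_smul, mul_inv_cancel₀ hp.ne', one_smul]
  · rw [map_smul, hAA, smul_smul]
    congr 1
    field_simp

/-- A nonzero skew-adjoint operator in dimension at most four has a Parseval frame of two rotated
pairs, the first of them orthonormal and rotated at least as fast as the second. -/
theorem exists_rotation_frame (hd : Module.finrank ℝ E ≤ 4) {A : E →ₗ[ℝ] E}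
    (hA : ∀ x y, ⟪A x, y⟫ = -⟪x, A y⟫) (hA0 : A ≠ 0) :
    ∃ (v : Fin 4 → E) (p q : ℝ), 0 < p ∧ |q| ≤ p ∧
      ⟪v 0, v 0⟫ = 1 ∧ ⟪v 1, v 1⟫ = 1 ∧ ⟪v 2, v 2⟫ ≤ 1 ∧ ⟪v 3, v 3⟫ ≤ 1 ∧
      (∀ a, A (v a) = ![p, -p, q, -q] a • v (partner a)) ∧ ∀ x, ∑ a, ⟪v a, x⟫ • v a = x := by
  obtain ⟨e₁, e₂, p, hp, h1, h2, h12, hAe₁, hAe₂, hbound⟩ := exists_maximal_rotation_plane hA hA0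
  have h21 : ⟪e₂, e₁⟫ = 0 := by rw [real_inner_comm, h12]
  set U : Submodule ℝ E := Submodule.span ℝ {e₁, e₂} with hU
  have hUW : ∀ w ∈ Uᗮ, ⟪e₁, w⟫ = 0 ∧ ⟪e₂, w⟫ = 0 := fun w hw =>
    ⟨Submodule.inner_right_of_mem_orthogonal (Submodule.subset_span (by simp)) hw,
      Submodule.inner_right_of_mem_orthogonal (Submodule.subset_span (by simp)) hw⟩
  have hWU : ∀ w, ⟪e₁, w⟫ = 0 → ⟪e₂, w⟫ = 0 → w ∈ Uᗮ := by
    intro w hw₁ hw₂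
    rw [Submodule.mem_orthogonal]
    intro u hu
    obtain ⟨a, b, rfl⟩ := Submodule.mem_span_pair.1 hu
    simp [inner_add_left, inner_smul_left, hw₁, hw₂]
  have hn1 : ⟪e₁, e₁⟫ = 1 := by rw [real_inner_self_eq_norm_sq, h1, one_pow]
  have hn2 : ⟪e₂, e₂⟫ = 1 := by rw [real_inner_self_eq_norm_sq, h2, one_pow]
  have hle : ∀ f : E, ‖f‖ ≤ 1 → ⟪f, f⟫ ≤ 1 := fun f hf => by
    rw [real_inner_self_eq_norm_sq]
    exact pow_le_one₀ (norm_nonneg _) hf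
  have hUd : Module.finrank ℝ U = 2 := by
    have hli : LinearIndependent ℝ ![e₁, e₂] := by
      rw [LinearIndependent.pair_iff]
      intro s t hst
      have a1 := congrArg (fun x => ⟪e₁, x⟫) hst
      have a2 := congrArg (fun x => ⟪e₂, x⟫) hst
      simp [inner_add_right, inner_smul_right, h12, h21, h1, h2] at a1 a2
      exact ⟨a1, a2⟩
    have := finrank_span_eq_card hli
    rwa [Matrix.range_cons_cons_empty, Fintype.card_fin] at this
  have hWd : Module.finrank ℝ Uᗮ ≤ 2 := by
    have := U.finrank_add_finrank_orthogonal
    omega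
  obtain ⟨f₁, f₂, hf₁, hf₂, hf⟩ := exists_parseval_pair hWd
  have hframe : ∀ x, ⟪e₁, x⟫ • e₁ + ⟪e₂, x⟫ • e₂ +
      ⟪(f₁ : E), x⟫ • (f₁ : E) + ⟪(f₂ : E), x⟫ • (f₂ : E) = x := by
    intro x
    have hw : x - (⟪e₁, x⟫ • e₁ + ⟪e₂, x⟫ • e₂) ∈ Uᗮ := by
      apply hWU <;> simp [inner_sub_right, inner_add_right, inner_smul_right, h12, h21, h1, h2]
    have h3 := congrArg (Subtype.val) (hf ⟨_, hw⟩)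
    obtain ⟨g1, g2⟩ := hUW f₁ f₁.2
    obtain ⟨g3, g4⟩ := hUW f₂ f₂.2
    rw [real_inner_comm] at g1 g2 g3 g4
    simp only [Submodule.coe_add, Submodule.coe_smul, Submodule.coe_inner, inner_sub_right,
      inner_add_right, inner_smul_right, g1, g2, g3, g4, mul_zero, add_zero, sub_zero] at h3
    rw [add_assoc, h3]
    abel
  have hskew : ∀ x, ⟪x, A x⟫ = 0 := by
    intro x
    have h1 := hA x x
    rw [real_inner_comm] at h1
    linarith
  obtain ⟨g1, g2⟩ := hUW f₁ f₁.2
  obtain ⟨g3, g4⟩ := hUW f₂ f₂.2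
  -- Skewness makes the orthogonal complement of the rotated plane invariant. Hence `A f₁` has only
  -- an `f₂` component, which defines `q`, and likewise for `A f₂`.
  have k : ∀ f : E, ⟪e₁, f⟫ = 0 → ⟪e₂, f⟫ = 0 → ⟪e₁, A f⟫ = 0 ∧ ⟪e₂, A f⟫ = 0 := by
    intro f hf1 hf2
    have a1 := hA e₁ f
    have a2 := hA e₂ f
    rw [hAe₁, inner_smul_left, hf2] at a1
    rw [hAe₂, inner_smul_left, hf1] at a2
    simp at a1 a2
    exact ⟨a1, a2⟩
  obtain ⟨k1, k2⟩ := k _ g1 g2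
  obtain ⟨k3, k4⟩ := k _ g3 g4
  refine ⟨![e₁, e₂, f₁, f₂], p, ⟪(f₂ : E), A f₁⟫, hp, ?_, hn1, hn2, hle _ hf₁, hle _ hf₂,
    ?_, ?_⟩
  · calc |⟪(f₂ : E), A f₁⟫| ≤ ‖(f₂ : E)‖ * ‖A f₁‖ := abs_real_inner_le_norm _ _
      _ ≤ 1 * (p * 1) := by
        gcongr
        · exact hf₂
        · exact (hbound _).trans (mul_le_mul_of_nonneg_left hf₁ hp.le)
      _ = p := by ring
  · intro a
    fin_cases a
    · exact hAe₁
    · exact hAe₂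
    · have := hframe (A f₁)
      rw [k1, k2, hskew] at this
      simpa [partner] using this.symm
    · have := hframe (A f₂)
      have e := hA f₁ f₂
      rw [real_inner_comm] at e
      rw [k3, k4, hskew, show ⟪(f₁ : E), A f₂⟫ = -⟪(f₂ : E), A f₁⟫ by linarith] at this
      simpa [partner] using this.symm
  · intro x
    simpa [Fin.sum_univ_four] using hframe x

end Frame

open scoped Matrix

/-- A nonzero endomorphism that is skew for a metric `h` in dimension at most four has a frame of
two rotated pairs that resolves `h⁻¹`, the first pair orthonormal and rotated at least as fast as
the second. -/
theorem exists_metric_rotation_frame {n : ℕ} (hn : n ≤ 4) {h A : Matrix (Fin n) (Fin n) ℝ}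
    (hh : h.PosDef) (hA : Aᵀ * h + h * A = 0) (hA0 : A ≠ 0) :
    ∃ (v : Fin 4 → Fin n → ℝ) (p q : ℝ), 0 < p ∧ |q| ≤ p ∧
      v 0 ⬝ᵥ h *ᵥ v 0 = 1 ∧ v 1 ⬝ᵥ h *ᵥ v 1 = 1 ∧ v 2 ⬝ᵥ h *ᵥ v 2 ≤ 1 ∧ v 3 ⬝ᵥ h *ᵥ v 3 ≤ 1 ∧
      (∀ a, A *ᵥ v a = ![p, -p, q, -q] a • v (partner a)) ∧
      ∀ i j, h⁻¹ i j = ∑ a, v a i * v a j := by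
  let _ := h.toNormedAddCommGroup hh
  let _ := h.toInnerProductSpace hh.posSemidef
  have hin : ∀ x y : Fin n → ℝ, inner ℝ x y = x ⬝ᵥ h *ᵥ y := fun x y => dotProduct_comm _ _
  have hskew : ∀ x y, inner ℝ (A.mulVecLin x) y = -inner ℝ x (A.mulVecLin y) := by
    intro x y
    rw [hin, hin, Matrix.mulVecLin_apply, Matrix.mulVecLin_apply, Matrix.mulVec_mulVec,
      eq_neg_of_add_eq_zero_right hA, Matrix.neg_mulVec, dotProduct_neg, neg_neg,
      ← Matrix.mulVec_mulVec, Matrix.dotProduct_mulVec x, Matrix.vecMul_transpose]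
  obtain ⟨v, p, q, hp, hq, h0, h1, h2, h3, hv, hf⟩ :=
    exists_rotation_frame (by simpa using hn) hskew
      (fun hc => hA0 (Matrix.ext_of_mulVec_single fun i =>
        (show A.mulVecLin _ = 0 by rw [hc]; rfl).trans (Matrix.zero_mulVec _).symm))
  refine ⟨v, p, q, hp, hq, (hin _ _).symm.trans h0, (hin _ _).symm.trans h1,
    (hin _ _).symm.trans_le h2, (hin _ _).symm.trans_le h3, hv, ?_⟩
  -- The frame identity applied to the standard basis vectors.
  have hinv : (Matrix.of fun i j => ∑ a, v a i * v a j) * h = 1 := by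
    ext i j
    have := congrFun (hf (Pi.single j 1)) i
    rw [Finset.sum_apply] at this
    rw [Matrix.one_apply, ← Pi.single_apply, ← this, Matrix.mul_apply]
    simp only [hin, Matrix.of_apply, Finset.sum_mul, Matrix.mulVec_single_one, dotProduct,
      Pi.smul_apply, smul_eq_mul, Matrix.col_apply]
    rw [Finset.sum_comm]
    exact Finset.sum_congr rfl fun a _ => Finset.sum_congr rfl fun k _ => by ring
  intro i j
  rw [Matrix.inv_eq_left_inv hinv, Matrix.of_apply]

end EinsteinPolynomial

open EinsteinPolynomial in
theorem mainTheorem10 (n : ℕ) (h : Matrix (Fin n) (Fin n) ℝ) (hh : h.PosDef) (κ : ℝ) (hκ : 0 < κ)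
    (P : MvPolynomial (Fin n) ℝ) (hP : EinsteinPolynomial.IsSolution h κ P)
    (hdim : 0 < EinsteinPolynomial.lieDimension (EinsteinPolynomial.automorphismGroup h P)) :
    5 ≤ n := by
  by_contra! hn
  obtain ⟨A, hA, hA0⟩ : ∃ A : Matrix (Fin n) (Fin n) ℝ, (∀ t : ℝ, ∃ g ∈ automorphismGroup h P,
      (g : Matrix (Fin n) (Fin n) ℝ) = NormedSpace.exp (t • A)) ∧ A ≠ 0 := by
    -- If zero were the only generator of a one-parameter subgroup, the span would be trivial.
    by_contra! hc
    have hbot : lieAlgebra (automorphismGroup h P) = ⊥ :=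
      Submodule.span_eq_bot.2 fun A hA => hc A hA
    rw [lieDimension, hbot, finrank_bot] at hdim
    exact hdim.ne rfl
  obtain ⟨v, p, q, hp, hq, h0, h1, h2, h3, hv, hf⟩ :=
    exists_metric_rotation_frame (by omega) hh (skew_of_exp_mem hA) hA0
  have hcon := fun c => cubicForm_contract hf hP (v c)
  refine invariant_cubic_rigidity (t := fun a b c => cubicForm P (v a) (v b) (v c)) hp hq hκ
    (fun a b c => cubicForm_swap₁₂ _ _ _) (fun a b c => cubicForm_swap₂₃ _ _ _)
    (fun c => cubicForm_trace hf hP.harmonic _) (fun a b c => ?_)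
    ((hcon 0).trans (by rw [h0, mul_one])) ((hcon 1).trans (by rw [h1, mul_one]))
    ((hcon 2).trans_le (mul_le_of_le_one_right hκ.le h2))
    ((hcon 3).trans_le (mul_le_of_le_one_right hκ.le h3))
  have hinv := cubicForm_invariant (linDeriv_eq_zero_of_exp_mem hA) (v a) (v b) (v c)
  rw [hv, hv, hv, cubicForm_smul, cubicForm_swap₁₂ _ (_ • _), cubicForm_smul,
    cubicForm_swap₂₃ _ _ (_ • _), cubicForm_swap₁₂ _ (_ • _), cubicForm_smul] at hinv
  rw [cubicForm_swap₁₂ (v a) (v (partner b)), cubicForm_swap₂₃ (v a) (v b),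
    cubicForm_swap₁₂ (v a) (v (partner c))]
  exact hinv
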